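/- Let $n,s$ be integers with $2\le s\le n$. A monic real polynomial $F=T^n+F_1T^{n-1}+\dots+F_n$ is called hyperbolic if all its roots are real; for such an $F$, the hyperbolic slice $\mathcal H_s(F)$ is the set of all monic hyperbolic polynomials $H=T^n+H_1T^{n-1}+\dots+H_n$ with $H_i=F_i$ for $1\le i\le s$. The slice is generic if it contains no polynomial with at most $s-1$ distinct roots. A polynomial $H\in\mathcal H_s(F)$ is minimal in $\mathcal H_s(F)$ if $H_{s+1}\le G_{s+1}$ for all $G\in\mathcal H_s(F)$ (for $s=n$ the slice is the single point $F$, which is then minimal). For a monic hyperbolic polynomial $G$ of degree $n$ let $p(G)$ be the partition of $n$ formed by the multiplicities of its distinct roots. Let $\mathcal P(m,k)$ be the set of partitions of $m$ into exactly $k$ parts. For partitions $p,q$ of $n$ write $p\le q$ if $p$ is obtained from $q$ by summing some of the parts of $q$ and reordering. A set $P\subseteq\mathcal P(n,s)$ is an $(n,s)$-Vandermonde covering if for every monic hyperbolic polynomial $F$ of degree $n$ there are $q\in P$ and $G\in\mathcal H_s(F)$ with $p(G)\le q$. Let $\mathcal P_{\min}(n,s)$ be the set of all partitions $p(H)$,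 where $H$ is a minimal polynomial in some generic hyperbolic slice $\mathcal H_s(F)$, with $F$ monic hyperbolic of degree $n$. Then $\mathcal P_{\min}(n,s)$ is an $(n,s)$-Vandermonde covering (in particular $\mathcal P_{\min}(n,s)\subseteq\mathcal P(n,s)$), and $$|\mathcal P_{\min}(n,s)|=\left|\mathcal P\left(n-\left\lceil\tfrac s2\right\rceil,\left\lfloor\tfrac s2\right\rfloor\right)\right|.$$ -/

import Mathlib

namespace HyperbolicSlice

open Polynomial

/-- The monic hyperbolic polynomials of degree `n`: monic real univariate polynomials
of degree `n` all of whose roots are real. -/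
def Hyp (n : ℕ) : Type :=
  {H : ℝ[X] // H.Monic ∧ H.natDegree = n ∧ H.Splits}

/-- The coefficient `H_i` in `H = T^n + H_1 T^(n-1) + ... + H_n`
(there is no such coefficient for `i > n`, and the value is then `0`). -/
noncomputable def Hyp.coef {n : ℕ} (H : Hyp n) (i : ℕ) : ℝ :=
  if i ≤ n then H.1.coeff (n - i) else 0

/-- The finite set of distinct roots. -/
noncomputable def Hyp.distinctRoots {n : ℕ} (H : Hyp n) : Finset ℝ :=
  H.1.roots.toFinset

theorem Hyp.card_roots {n : ℕ} (H : Hyp n) : Multiset.card H.1.roots = n := by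
  rw [← H.2.2.2.natDegree_eq_card_roots, H.2.2.1]

/-- The partition `p(H)` of `n` whose parts are the multiplicities of the distinct roots. -/
noncomputable def Hyp.partition {n : ℕ} (H : Hyp n) : n.Partition where
  parts := H.distinctRoots.val.map fun x => H.1.rootMultiplicity x
  parts_pos := by
    intro i hi
    obtain ⟨x, hx, rfl⟩ := Multiset.mem_map.1 hi
    have hx' : x ∈ H.1.roots := Multiset.mem_toFinset.1 hx
    rw [← count_roots]
    exact Multiset.count_pos.2 hx'
  parts_sum := by
    have h := Multiset.toFinset_sum_count_eq H.1.roots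
    rw [H.card_roots] at h
    simp only [count_roots] at h
    exact h

/-- The hyperbolic slice `H_s(F)`: the monic hyperbolic polynomials of the degree of `F`
with the same coefficients `H_1, ..., H_s` as `F`. -/
def slice {n : ℕ} (s : ℕ) (F : Hyp n) : Set (Hyp n) :=
  {H | ∀ i, 1 ≤ i → i ≤ s → H.coef i = F.coef i}

/-- `H_s(F)` is generic if it contains no polynomial with at most `s - 1` distinct roots. -/
def IsGeneric {n : ℕ} (s : ℕ) (F : Hyp n) : Prop :=
  ∀ H ∈ slice s F, ¬ H.distinctRoots.card < s

/-- `H` is a minimal polynomial of `H_s(F)`: it lies in the slice, and its first free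
coefficient `H_(s+1)` is minimal among the elements of the slice. (For `s = n` the slice is
the single point `F`, which is then minimal.) -/
def IsMinimalPoly {n : ℕ} (s : ℕ) (F H : Hyp n) : Prop :=
  H ∈ slice s F ∧ ∀ G ∈ slice s F, H.coef (s + 1) ≤ G.coef (s + 1)

/-- `P(n, s)`: the partitions of `n` into (exactly) `s` parts. -/
def partitionsInto (n s : ℕ) : Set n.Partition :=
  {p | Multiset.card p.parts = s}

/-- The order `p ≤ q` on partitions of `n`: the parts of `q` can be grouped into blocks
such that the parts of `p` are the sums of the blocks. -/
def Coarsens {n : ℕ} (p q : n.Partition) : Prop :=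
  ∃ B : Multiset (Multiset ℕ), B.join = q.parts ∧ B.map Multiset.sum = p.parts

/-- `P_min(n, s)`: the partitions of `n` that correspond to a minimal polynomial of some
generic hyperbolic slice `H_s(F)` with `F` of degree `n`. -/
def minPartitions (n s : ℕ) : Set n.Partition :=
  {p | ∃ F H : Hyp n, IsGeneric s F ∧ IsMinimalPoly s F H ∧ H.partition = p}

/-- `P` is an `(n, s)`-Vandermonde covering: it consists of partitions of `n` into `s` parts,
and every hyperbolic slice `H_s(F)` contains some `G` with `p(G) ≤ q` for some `q ∈ P`. -/
def IsVandermondeCovering (n s : ℕ) (P : Set n.Partition) : Prop :=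
  P ⊆ partitionsInto n s ∧
    ∀ F : Hyp n, ∃ q ∈ P, ∃ G ∈ slice s F, Coarsens G.partition q

end HyperbolicSlice

/-
On root vectors, membership in a slice is equality of the power sums of degrees `1, …, s`, and a
smaller `H_(s+1)` is a larger power sum of degree `s + 1`.

Minimal polynomials of generic slices: let `H` have exactly `s` distinct roots, listed in
decreasing order, and suppose those at the positions `1, 3, 5, …` are simple. If `G` lies in the
slice of `H`, the difference of the root counting functions of `H` and `G` is integer valued and
orthogonal to all polynomials of degree `< s`; simplicity of the odd roots makes its integral
against a suitable monic polynomial of degree `s`, positive or negative according to the side of the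
even positions, have a definite sign, and this integral is the difference of the power sums of
degree `s + 1`. Hence `H` is minimal. Conversely, if a root at an odd position is multiple, or if
there are more than `s` distinct roots, then for a suitable monic `A` of degree `n - s - 1` the
polynomials `H - ε A` with small `ε > 0` are still hyperbolic, so `H` is not minimal.

Covering: the degenerate power sums form a set of dimension less than `s`, so generic slices are
dense, and each has a minimal polynomial since power sums define a proper map when `s ≥ 2`. That a
slice contains a coarsening of a minimal partition is a closed condition, so it holds for every
slice.

Counting: realising a partition with `s` parts by a vector of distinct roots that can be moved into
general position, one sees that `P_min(n, s)` consists of the partitions with `s` parts of which at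
least `⌈s / 2⌉` are equal to `1`; removing `⌈s / 2⌉` of these leaves an arbitrary partition of
`n - ⌈s / 2⌉` into `⌊s / 2⌋` parts.
-/

namespace HyperbolicSlice

open Finset Polynomial Filter Topology

section PowerSums

variable {n s : ℕ}

/-- The monic hyperbolic polynomial `∏ i, (T - x i)` with prescribed roots. -/
noncomputable def ofRoots (x : Fin n → ℝ) : Hyp n :=
  ⟨∏ i, (X - C (x i)), monic_prod_X_sub_C _ _, by simp, Splits.prod fun i _ => Splits.X_sub_C _⟩

theorem ofRoots_eq_multiset_prod (x : Fin n → ℝ) :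
    (ofRoots x).1 = ((univ.val.map x).map fun a => X - C a).prod := by
  rw [Multiset.map_map]
  rfl

theorem roots_ofRoots (x : Fin n → ℝ) : (ofRoots x).1.roots = univ.val.map x := by
  rw [ofRoots_eq_multiset_prod, roots_multiset_prod_X_sub_C]

theorem distinctRoots_ofRoots (x : Fin n → ℝ) : (ofRoots x).distinctRoots = univ.image x := by
  rw [Hyp.distinctRoots, roots_ofRoots]
  rfl

theorem rootMultiplicity_ofRoots (x : Fin n → ℝ) (z : ℝ) :
    (ofRoots x).1.rootMultiplicity z = #{i | x i = z} := by
  rw [← count_roots, roots_ofRoots, Multiset.count_map]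
  simp only [eq_comm (a := z)]
  rfl

theorem Hyp.ext_roots {H G : Hyp n} (h : H.1.roots = G.1.roots) : H = G := by
  apply Subtype.ext
  rw [H.2.2.2.eq_prod_roots_of_monic H.2.1, G.2.2.2.eq_prod_roots_of_monic G.2.1, h]

theorem exists_monotone_ofRoots (H : Hyp n) : ∃ x : Fin n → ℝ, Monotone x ∧ ofRoots x = H := by
  set l := H.1.roots.sort (· ≤ ·) with hl
  have hlen : l.length = n := by rw [Multiset.length_sort, H.card_roots]
  refine ⟨fun i => l.get (i.cast hlen.symm), fun i j hij => ?_, Hyp.ext_roots ?_⟩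
  · exact (Multiset.pairwise_sort H.1.roots (· ≤ ·)).sortedLE.monotone_get (by simpa using hij)
  · rw [roots_ofRoots, ← Multiset.sort_eq H.1.roots (· ≤ ·), ← hl]
    clear_value l
    subst hlen
    simp

theorem Hyp.coef_zero (H : Hyp n) : H.coef 0 = 1 := by
  have := H.2.1.coeff_natDegree
  rw [H.2.2.1] at this
  simp [Hyp.coef, this]

theorem coef_ofRoots (x : Fin n → ℝ) (i : ℕ) :
    (ofRoots x).coef i = (-1) ^ i * MvPolynomial.aeval x (MvPolynomial.esymm (Fin n) ℝ i) := by
  rw [MvPolynomial.aeval_esymm_eq_multiset_esymm, Hyp.coef]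
  split_ifs with h
  · rw [ofRoots_eq_multiset_prod, Multiset.prod_X_sub_C_coeff _ (by simp)]
    simp only [Multiset.card_map, card_val, card_univ, Fintype.card_fin, Nat.sub_sub_self h]
  · rw [Multiset.esymm, Multiset.powersetCard_eq_empty _ (by simpa using h)]
    simp

theorem mul_coef_eq_neg_sum (x : Fin n → ℝ) (k : ℕ) :
    k * (ofRoots x).coef k =
      -∑ a ∈ antidiagonal k with a.1 < k, (ofRoots x).coef a.1 * ∑ i, x i ^ a.2 := by
  have newton := congrArg (MvPolynomial.aeval x) (MvPolynomial.mul_esymm_eq_sum (Fin n) ℝ k)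
  simp only [map_mul, map_natCast, map_pow, map_neg, map_one, map_sum, MvPolynomial.psum,
    MvPolynomial.aeval_X] at newton
  simp only [coef_ofRoots]
  rw [mul_left_comm, newton, ← mul_assoc, ← pow_add, show k + (k + 1) = 2 * k + 1 by ring,
    pow_succ, pow_mul]
  simp

theorem coef_succ_sub_coef_succ {x y : Fin n → ℝ} (h : ofRoots x ∈ slice s (ofRoots y))
    (hp : ∀ k < s, ∑ i, x i ^ (k + 1) = ∑ i, y i ^ (k + 1)) :
    (s + 1) * ((ofRoots x).coef (s + 1) - (ofRoots y).coef (s + 1)) =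
      ∑ i, y i ^ (s + 1) - ∑ i, x i ^ (s + 1) := by
  have hx := mul_coef_eq_neg_sum x (s + 1)
  have hy := mul_coef_eq_neg_sum y (s + 1)
  have hdiff : (∑ a ∈ antidiagonal (s + 1) with a.1 < s + 1,
      ((ofRoots x).coef a.1 * ∑ i, x i ^ a.2 - (ofRoots y).coef a.1 * ∑ i, y i ^ a.2)) =
      ∑ i, x i ^ (s + 1) - ∑ i, y i ^ (s + 1) := by
    rw [sum_eq_single (0, s + 1)]
    · simp [Hyp.coef_zero]
    · rintro ⟨i, j⟩ hij hne
      obtain ⟨hsum, hlt⟩ := mem_filter.1 hij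
      rw [HasAntidiagonal.mem_antidiagonal] at hsum
      have hi : i ≠ 0 := by
        rintro rfl
        exact hne (by rw [← hsum, zero_add])
      obtain ⟨k, rfl⟩ : ∃ k, j = k + 1 := ⟨j - 1, by grind⟩
      rw [h i (by lia) (by lia), hp k (by lia), sub_self]
    · simp
  rw [sum_sub_distrib] at hdiff
  push_cast at hx hy
  linarith

theorem ofRoots_mem_slice_iff {x y : Fin n → ℝ} :
    ofRoots x ∈ slice s (ofRoots y) ↔ ∀ k < s, ∑ i, x i ^ (k + 1) = ∑ i, y i ^ (k + 1) := by
  induction s with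
  | zero => exact ⟨fun _ k hk => by lia, fun _ i h1 h0 => by lia⟩
  | succ s ih =>
    have hslice : ofRoots x ∈ slice (s + 1) (ofRoots y) ↔ ofRoots x ∈ slice s (ofRoots y) ∧
        (ofRoots x).coef (s + 1) = (ofRoots y).coef (s + 1) := by
      refine ⟨fun h => ⟨fun i h1 hi => h i h1 (by lia), h _ (by lia) le_rfl⟩, ?_⟩
      rintro ⟨h, heq⟩ i h1 hi
      obtain rfl | hi := Nat.le_succ_iff_eq_or_le.1 hi
      exacts [heq, h i h1 hi]
    rw [hslice, Nat.forall_lt_succ_right, ← ih]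
    refine and_congr_right fun h => ?_
    have hsub := coef_succ_sub_coef_succ h (ih.1 h)
    constructor
    · intro heq
      rw [heq, sub_self, mul_zero] at hsub
      exact (sub_eq_zero.1 hsub.symm).symm
    · intro heq
      rw [heq, sub_self] at hsub
      exact sub_eq_zero.1 ((mul_eq_zero.1 hsub).resolve_left (by positivity))

theorem coef_succ_le_iff {x y : Fin n → ℝ} (h : ofRoots x ∈ slice s (ofRoots y)) :
    (ofRoots x).coef (s + 1) ≤ (ofRoots y).coef (s + 1) ↔
      ∑ i, y i ^ (s + 1) ≤ ∑ i, x i ^ (s + 1) := by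
  have hsub := coef_succ_sub_coef_succ h (ofRoots_mem_slice_iff.1 h)
  have hs : (0 : ℝ) < s + 1 := by positivity
  rw [← mul_le_mul_iff_right₀ hs]
  constructor <;> intro _ <;> linarith

end PowerSums

section EvenPositions

variable {α β : Type*} [LinearOrder α] [LinearOrder β]

/-- The elements at the positions `2, 4, 6, …` when `S` is listed in decreasing order. -/
def evenPositions (S : Finset α) : Finset α := {z ∈ S | Odd #{x ∈ S | z < x}}

theorem evenPositions_subset (S : Finset α) : evenPositions S ⊆ S := filter_subset _ _

theorem evenPositions_image {f : α → β} (hf : StrictMono f) (S : Finset α) :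
    evenPositions (S.image f) = (evenPositions S).image f := by
  simp only [evenPositions, filter_image, hf.lt_iff_lt, card_image_of_injective _ hf.injective]

theorem card_evenPositions (S : Finset α) : #(evenPositions S) = #S / 2 := by
  induction S using Finset.induction_on_min with
  | empty => simp [evenPositions]
  | insert a S ha ih =>
    have haS : a ∉ S := fun h => lt_irrefl _ (ha a h)
    have habove : ∀ z ∈ insert a S, #{x ∈ insert a S | z < x} = #{x ∈ S | z < x} := by
      intro z hz
      rw [filter_insert, if_neg]
      obtain rfl | hz := mem_insert.1 hz
      exacts [lt_irrefl _, (ha z hz).not_gt]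
    have hevenPositions : evenPositions (insert a S) =
        if Odd #S then insert a (evenPositions S) else evenPositions S := by
      rw [evenPositions, filter_congr fun z hz => by rw [habove z hz], filter_insert,
        filter_true_of_mem ha]
      rfl
    rw [hevenPositions, card_insert_of_notMem haS]
    split_ifs with hS
    · rw [card_insert_of_notMem fun h => haS (evenPositions_subset S h), ih]
      grind
    · grind

theorem exists_mem_evenPositions_between {S : Finset α} {z z' : α} (hz : z ∈ S) (hz' : z' ∈ S)
    (hlt : z < z') (hzB : z ∉ evenPositions S) (hzB' : z' ∉ evenPositions S) :
    ∃ b ∈ evenPositions S, z < b ∧ b < z' := by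
  have hne : {x ∈ S | x < z'}.Nonempty := ⟨z, mem_filter.2 ⟨hz, hlt⟩⟩
  set b := {x ∈ S | x < z'}.max' hne with hb
  obtain ⟨hbS, hbz'⟩ := mem_filter.1 ({x ∈ S | x < z'}.max'_mem hne)
  rw [← hb] at hbS hbz'
  have hmax : ∀ x ∈ S, x < z' → x ≤ b := fun x hx h => le_max' _ x (mem_filter.2 ⟨hx, h⟩)
  have habove : ({x ∈ S | b < x} : Finset α) = insert z' {x ∈ S | z' < x} := by grind
  have hbB : b ∈ evenPositions S := by
    simp only [evenPositions, mem_filter, hz', true_and, Nat.not_odd_iff_even] at hzB'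
    rw [evenPositions, mem_filter, habove, card_insert_of_notMem (by simp)]
    exact ⟨hbS, hzB'.add_one⟩
  exact ⟨b, hbB, lt_of_le_of_ne (hmax z hz hlt) (by rintro rfl; exact hzB hbB), hbz'⟩

theorem exists_mem_evenPositions_le {S : Finset α} (hS : Even #S) {z : α} (hz : z ∈ S) :
    ∃ b ∈ evenPositions S, b ≤ z := by
  have hne : S.Nonempty := ⟨z, hz⟩
  refine ⟨S.min' hne, ?_, min'_le S z hz⟩
  have habove : {x ∈ S | S.min' hne < x} = S.erase (S.min' hne) := by
    ext x
    simp only [mem_filter, mem_erase, and_comm (a := x ∈ S)]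
    exact and_congr_left fun hx => (min'_le S x hx).lt_iff_ne.trans ne_comm
  rw [evenPositions, mem_filter, habove, card_erase_of_mem (min'_mem S hne)]
  exact ⟨min'_mem S hne, Nat.Even.sub_odd (card_pos.2 hne) hS odd_one⟩

end EvenPositions

section NextPowerSum

open intervalIntegral

/-- The zeros of the polynomial are the points of `B`, each paired with the last point of `A`
before the next point of `B`, and one more zero when `r = 1`. -/
theorem exists_sign_polynomial {A N : Set ℝ} {B : Finset ℝ} {r : ℕ} (hA : BddAbove A)
    (hN : BddBelow N) (hsep : ∀ t ∈ N, ∀ u ∈ A, t ≤ u → ∃ b ∈ B, t < b ∧ b ≤ u)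
    (hr : (r = 0 ∧ ∀ u ∈ A, ∃ b ∈ B, b ≤ u) ∨ r = 1) :
    ∃ f : ℝ[X], f.Monic ∧ f.natDegree = 2 * #B + r ∧ (∀ t ∈ A, f.eval t ≤ 0) ∧
      ∀ t ∈ N, 0 ≤ f.eval t := by
  induction B using Finset.induction_on_max generalizing A N with
  | empty =>
    obtain ⟨rfl, hlow⟩ | rfl := hr
    · exact ⟨1, monic_one, by simp, fun t ht => by simpa using hlow t ht, by simp⟩
    · obtain ⟨m, hm⟩ := hN
      refine ⟨X - C (sSup (insert m A)), monic_X_sub_C _, by simp, fun t ht => ?_, fun t ht => ?_⟩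
      · simpa using le_csSup (hA.insert m) (Set.mem_insert_of_mem m ht)
      · have hc : sSup (insert m A) ≤ t := by
          refine csSup_le (Set.insert_nonempty m A) ?_
          rintro u (rfl | hu)
          exacts [hm ht, le_of_not_ge fun htu => by simpa using hsep t ht u hu htu]
        simpa using hc
  | insert b B hB ih =>
    have hbB : b ∉ B := fun h => lt_irrefl _ (hB b h)
    obtain ⟨f, hf, hdeg, hfA, hfN⟩ := ih (A := A ∩ Set.Iio b) (N := N ∪ Set.Ici b)
      (hA.mono Set.inter_subset_left) (hN.union bddBelow_Ici) (by grind) (by grind)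
    set c := sSup (insert b A)
    have hbc : b ≤ c := le_csSup (hA.insert b) (Set.mem_insert b A)
    have hAc : ∀ t ∈ A, t ≤ c := fun t ht => le_csSup (hA.insert b) (Set.mem_insert_of_mem b ht)
    have hNc : ∀ t ∈ N, b ≤ t → c ≤ t := by
      refine fun t ht hbt => csSup_le (Set.insert_nonempty b A) ?_
      rintro u (rfl | hu)
      · exact hbt
      · by_contra! htu
        obtain ⟨b', hb', htb', _⟩ := hsep t ht u hu htu.le
        grind
    refine ⟨f * ((X - C b) * (X - C c)), hf.mul ((monic_X_sub_C b).mul (monic_X_sub_C c)), ?_,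
      fun t ht => ?_, fun t ht => ?_⟩
    · rw [hf.natDegree_mul ((monic_X_sub_C b).mul (monic_X_sub_C c)),
        (monic_X_sub_C b).natDegree_mul (monic_X_sub_C c), hdeg, card_insert_of_notMem hbB]
      simp only [natDegree_X_sub_C]
      ring
    all_goals simp only [eval_mul, eval_sub, eval_X, eval_C]
    · obtain htb | hbt := lt_or_ge t b
      · exact mul_nonpos_of_nonpos_of_nonneg (hfA t ⟨ht, htb⟩) (by nlinarith)
      · exact mul_nonpos_of_nonneg_of_nonpos (hfN t (Or.inr hbt)) (by nlinarith [hAc t ht])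
    · obtain htb | hbt := lt_or_ge t b
      · exact mul_nonneg (hfN t (Or.inl ht)) (by nlinarith)
      · exact mul_nonneg (hfN t (Or.inr hbt)) (by nlinarith [hNc t ht hbt])

theorem integral_eval (f : ℝ[X]) (a b : ℝ) :
    ∫ t in a..b, f.eval t =
      ∑ i ∈ range (f.natDegree + 1), f.coeff i / (i + 1) * (b ^ (i + 1) - a ^ (i + 1)) := by
  simp only [eval_eq_sum_range]
  rw [integral_finsetSum fun i _ => (by fun_prop : Continuous _).intervalIntegrable _ _]
  simp only [integral_const_mul, integral_pow, mul_div_assoc', div_mul_eq_mul_div]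

variable {ι : Type*} [Fintype ι] {s : ℕ} {x y : ι → ℝ}

theorem sum_integral_eval {f : ℝ[X]} (hf : f.Monic) (hdeg : f.natDegree = s)
    (hp : ∀ k < s, ∑ i, x i ^ (k + 1) = ∑ i, y i ^ (k + 1)) :
    ∑ i, ∫ t in x i..y i, f.eval t = (∑ i, y i ^ (s + 1) - ∑ i, x i ^ (s + 1)) / (s + 1) := by
  simp only [integral_eval]
  rw [sum_comm, hdeg, sum_range_succ, sum_eq_zero, zero_add, ← hdeg, hf.coeff_natDegree,
    ← mul_sum, sum_sub_distrib, one_div_mul_eq_div]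
  intro k hk
  rw [← mul_sum, sum_sub_distrib, hp k (mem_range.1 hk), sub_self, mul_zero]

theorem sum_pow_succ_le_of_eval_sign {f : ℝ[X]} (hf : f.Monic) (hdeg : f.natDegree = s)
    (hpos : ∀ i, ∀ t ∈ Set.Ico (x i) (y i), 0 ≤ f.eval t)
    (hneg : ∀ i, ∀ t ∈ Set.Ico (y i) (x i), f.eval t ≤ 0)
    (hp : ∀ k < s, ∑ i, x i ^ (k + 1) = ∑ i, y i ^ (k + 1)) :
    ∑ i, x i ^ (s + 1) ≤ ∑ i, y i ^ (s + 1) := by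
  have hint : ∀ i, 0 ≤ ∫ t in x i..y i, f.eval t := by
    intro i
    obtain hle | hle := le_total (x i) (y i)
    · rw [integral_of_le hle, ← MeasureTheory.integral_Ico_eq_integral_Ioc]
      exact MeasureTheory.setIntegral_nonneg measurableSet_Ico (hpos i)
    · rw [integral_symm, neg_nonneg, integral_of_le hle,
        ← MeasureTheory.integral_Ico_eq_integral_Ioc]
      exact MeasureTheory.setIntegral_nonpos measurableSet_Ico (hneg i)
  have hsum := sum_nonneg fun i (_ : i ∈ univ) => hint i
  rwa [sum_integral_eval hf hdeg hp, le_div_iff₀ (by positivity), zero_mul, sub_nonneg] at hsum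

theorem sum_pow_succ_le_of_separated [LinearOrder ι] (hx : Monotone x) (hy : Monotone y)
    {B : Finset ℝ} (hB : ∀ i j, i < j → y i ∉ B → y j ∉ B → ∃ b ∈ B, y i < b ∧ b < y j)
    (hs : s / 2 = #B) (hlow : Even s → ∀ i, ∃ b ∈ B, b ≤ y i)
    (hp : ∀ k < s, ∑ i, x i ^ (k + 1) = ∑ i, y i ^ (k + 1)) :
    ∑ i, x i ^ (s + 1) ≤ ∑ i, y i ^ (s + 1) := by
  set A : Set ℝ := ⋃ i, Set.Ico (y i) (x i) with hA
  set N : Set ℝ := ⋃ i, Set.Ico (x i) (y i) with hN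
  have hsep : ∀ t ∈ N, ∀ u ∈ A, t ≤ u → ∃ b ∈ B, t < b ∧ b ≤ u := by
    simp only [hA, hN, Set.mem_iUnion]
    rintro t ⟨i, hxt, hty⟩ u ⟨j, hyu, hux⟩ htu
    have hij : i < j := hx.reflect_lt (by order)
    have hle := hy hij.le
    by_cases hi : y i ∈ B
    · exact ⟨y i, hi, hty, hle.trans hyu⟩
    by_cases hj : y j ∈ B
    · exact ⟨y j, hj, hty.trans_le hle, hyu⟩
    obtain ⟨b, hb, h1, h2⟩ := hB i j hij hi hj
    exact ⟨b, hb, hty.trans h1, h2.le.trans hyu⟩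
  have hr : (s % 2 = 0 ∧ ∀ u ∈ A, ∃ b ∈ B, b ≤ u) ∨ s % 2 = 1 := by
    refine (Nat.mod_two_eq_zero_or_one s).imp_left fun h => ⟨h, ?_⟩
    simp only [hA, Set.mem_iUnion]
    rintro u ⟨i, hyu, _⟩
    obtain ⟨b, hb, hby⟩ := hlow (Nat.even_iff.2 h) i
    exact ⟨b, hb, hby.trans hyu⟩
  have hAbdd : BddAbove A := by
    obtain ⟨M, hM⟩ := (Set.finite_range x).bddAbove
    exact ⟨M, Set.iUnion_subset fun i t ht => ht.2.le.trans (hM ⟨i, rfl⟩)⟩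
  have hNbdd : BddBelow N := by
    obtain ⟨m, hm⟩ := (Set.finite_range x).bddBelow
    exact ⟨m, Set.iUnion_subset fun i t ht => (hm ⟨i, rfl⟩).trans ht.1⟩
  obtain ⟨f, hf, hdeg, hfA, hfN⟩ := exists_sign_polynomial hAbdd hNbdd hsep hr
  rw [← hs, Nat.div_add_mod] at hdeg
  exact sum_pow_succ_le_of_eval_sign hf hdeg
    (fun i t ht => hfN t (Set.mem_iUnion_of_mem i ht))
    (fun i t ht => hfA t (Set.mem_iUnion_of_mem i ht)) hp

end NextPowerSum

section Perturbation

theorem exists_isRoot_mem_Ioo {Q : ℝ[X]} {a b : ℝ} (hab : a ≤ b) (h : Q.eval a * Q.eval b < 0) :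
    ∃ t ∈ Set.Ioo a b, Q.IsRoot t := by
  have hcont : ContinuousOn (fun t => Q.eval t) (Set.Icc a b) := Q.continuousOn
  obtain ⟨ha, hb⟩ | ⟨ha, hb⟩ := mul_neg_iff.1 h
  · exact intermediate_value_Ioo' hab hcont ⟨hb, ha⟩
  · exact intermediate_value_Ioo hab hcont ⟨ha, hb⟩

theorem eventually_eval_sub_C_mul_mul_pos {P : ℝ[X]} (A : ℝ[X]) {a c : ℝ} (h : 0 < P.eval a * c) :
    ∀ᶠ ε in 𝓝[>] (0 : ℝ), 0 < (P - C ε * A).eval a * c := by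
  apply nhdsWithin_le_nhds
  have hcont : Continuous fun ε : ℝ => (P - C ε * A).eval a * c := by
    simp only [eval_sub, eval_mul, eval_C]
    fun_prop
  exact hcont.continuousAt.eventually_const_lt (by simpa using h)

theorem exists_Icc_subset_mul_eval_pos {R : ℝ[X]} {z : ℝ} (hR : R.eval z ≠ 0) {U : Set ℝ}
    (hU : U ∈ 𝓝 z) : ∃ δ > 0, Set.Icc (z - δ) (z + δ) ⊆ U ∧
      0 < R.eval (z - δ) * R.eval z ∧ 0 < R.eval (z + δ) * R.eval z := by
  have hsign : ∀ᶠ t in 𝓝 z, t ∈ U ∧ 0 < R.eval t * R.eval z :=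
    (eventually_mem_set.2 hU).and
      ((R.continuous.mul_const _).continuousAt.eventually_const_lt (mul_self_pos.2 hR))
  obtain ⟨δ, hδ, hball⟩ := Metric.nhds_basis_closedBall.eventually_iff.1 hsign
  simp only [Real.closedBall_eq_Icc] at hball
  exact ⟨δ, hδ, fun t ht => (hball ht).1, (hball ⟨le_rfl, by linarith⟩).2,
    (hball ⟨by linarith, le_rfl⟩).2⟩

variable {P A R : ℝ[X]} {z : ℝ} {U : Set ℝ}

theorem eventually_exists_isRoot_of_simple (hP : P = (X - C z) * R) (hR : R.eval z ≠ 0)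
    (hU : U ∈ 𝓝 z) : ∀ᶠ ε in 𝓝[>] (0 : ℝ), ∃ t ∈ U, (P - C ε * A).IsRoot t := by
  obtain ⟨δ, hδ, hIcc, hRl, hRr⟩ := exists_Icc_subset_mul_eval_pos hR hU
  have hPl : 0 < P.eval (z - δ) * -R.eval z := by
    simp only [hP, eval_mul, eval_sub, eval_X, eval_C]
    nlinarith
  have hPr : 0 < P.eval (z + δ) * R.eval z := by
    simp only [hP, eval_mul, eval_sub, eval_X, eval_C]
    nlinarith
  filter_upwards [eventually_eval_sub_C_mul_mul_pos A hPl,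
    eventually_eval_sub_C_mul_mul_pos A hPr] with ε hl hr
  obtain ⟨t, ht, ht0⟩ := exists_isRoot_mem_Ioo (Q := P - C ε * A) (a := z - δ) (b := z + δ)
    (by linarith) (neg_of_mul_neg_left (by nlinarith) (mul_self_nonneg (R.eval z)))
  exact ⟨t, hIcc (Set.Ioo_subset_Icc_self ht), ht0⟩

/-- At `z ± δ` the perturbed polynomial keeps the sign of `P`, which is the sign of `R z`; at `z`
it takes the value `-ε * A z` of the opposite sign. -/
theorem eventually_exists_isRoot_pair_of_double (hP : P = (X - C z) ^ 2 * R)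
    (hA : 0 < A.eval z * R.eval z) (hU : U ∈ 𝓝 z) :
    ∀ᶠ ε in 𝓝[>] (0 : ℝ), ∃ t ∈ U, ∃ t' ∈ U,
      t < t' ∧ (P - C ε * A).IsRoot t ∧ (P - C ε * A).IsRoot t' := by
  obtain ⟨δ, hδ, hIcc, hRl, hRr⟩ := exists_Icc_subset_mul_eval_pos (right_ne_zero_of_mul hA.ne') hU
  have hPl : 0 < P.eval (z - δ) * R.eval z := by
    simp only [hP, eval_mul, eval_pow, eval_sub, eval_X, eval_C]
    nlinarith [pow_pos hδ 2]
  have hPr : 0 < P.eval (z + δ) * R.eval z := by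
    simp only [hP, eval_mul, eval_pow, eval_sub, eval_X, eval_C]
    nlinarith [pow_pos hδ 2]
  filter_upwards [eventually_eval_sub_C_mul_mul_pos A hPl,
    eventually_eval_sub_C_mul_mul_pos A hPr, self_mem_nhdsWithin] with ε hl hr hε
  have hz : (P - C ε * A).eval z * R.eval z < 0 := by
    simp only [hP, eval_sub, eval_mul, eval_pow, eval_X, eval_C, sub_self]
    nlinarith [mul_pos (Set.mem_Ioi.1 hε) hA]
  obtain ⟨t, ht, ht0⟩ := exists_isRoot_mem_Ioo (Q := P - C ε * A) (a := z - δ) (b := z)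
    (by linarith) (neg_of_mul_neg_left (by nlinarith) (mul_self_nonneg (R.eval z)))
  obtain ⟨t', ht', ht0'⟩ := exists_isRoot_mem_Ioo (Q := P - C ε * A) (a := z) (b := z + δ)
    (by linarith) (neg_of_mul_neg_left (by nlinarith) (mul_self_nonneg (R.eval z)))
  exact ⟨t, hIcc ⟨ht.1.le, by linarith [ht.2]⟩, t', hIcc ⟨by linarith [ht'.1], ht'.2.le⟩,
    ht.2.trans ht'.1, ht0, ht0'⟩

theorem eventually_exists_finset_isRoot {m : ℕ} (hP : P = (X - C z) ^ m * R)
    (hR : R.eval z ≠ 0) (hm : m = 1 ∨ m = 2 ∧ 0 < A.eval z * R.eval z) (hU : U ∈ 𝓝 z) :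
    ∀ᶠ ε in 𝓝[>] (0 : ℝ),
      ∃ T : Finset ℝ, #T = m ∧ ∀ t ∈ T, t ∈ U ∧ (P - C ε * A).IsRoot t := by
  obtain rfl | ⟨rfl, hA⟩ := hm
  · rw [pow_one] at hP
    filter_upwards [eventually_exists_isRoot_of_simple (A := A) hP hR hU] with ε ⟨t, htU, ht⟩
    exact ⟨{t}, card_singleton t, fun x hx => mem_singleton.1 hx ▸ ⟨htU, ht⟩⟩
  · filter_upwards [eventually_exists_isRoot_pair_of_double hP hA hU]
      with ε ⟨t, htU, t', htU', hne, ht, ht'⟩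
    refine ⟨{t, t'}, card_pair hne.ne, fun x hx => ?_⟩
    obtain rfl | rfl := mem_insert.1 hx |>.imp_right mem_singleton.1
    exacts [⟨htU, ht⟩, ⟨htU', ht'⟩]

theorem eventually_splits_sub_C_mul {S : Finset ℝ} {m : ℝ → ℕ}
    (hP : P = ∏ z ∈ S, (X - C z) ^ m z) (hA : A.natDegree < P.natDegree)
    (hm : ∀ z ∈ S, m z = 1 ∨ m z = 2 ∧ 0 < A.eval z * ∏ x ∈ S.erase z, (z - x) ^ m x) :
    ∀ᶠ ε in 𝓝[>] (0 : ℝ), (P - C ε * A).Splits := by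
  obtain ⟨U, hU, hdisj⟩ := S.finite_toSet.t2_separation
  have hroots : ∀ᶠ ε in 𝓝[>] (0 : ℝ), ∀ z ∈ S,
      ∃ T : Finset ℝ, #T = m z ∧ ∀ t ∈ T, t ∈ U z ∧ (P - C ε * A).IsRoot t := by
    rw [eventually_all_finset]
    intro z hz
    refine eventually_exists_finset_isRoot (R := ∏ x ∈ S.erase z, (X - C x) ^ m x)
      (by rw [hP, mul_prod_erase S (fun x => (X - C x) ^ m x) hz]) ?_ ?_
      ((hU z).2.mem_nhds (hU z).1)
    · rw [eval_prod, prod_ne_zero_iff]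
      intro x hx
      simpa using pow_ne_zero _ (sub_ne_zero.2 (ne_of_mem_erase hx).symm)
    · simpa [eval_prod] using hm z hz
  have hPdeg : P.natDegree = ∑ z ∈ S, m z := by
    rw [hP, natDegree_prod_of_monic _ _ fun z _ => (monic_X_sub_C z).pow _]
    simp
  filter_upwards [hroots] with ε hε
  choose! T hcard hT using hε
  have hQdeg : (P - C ε * A).natDegree = P.natDegree :=
    natDegree_sub_eq_left_of_natDegree_lt ((natDegree_C_mul_le _ _).trans_lt hA)
  have hQ : P - C ε * A ≠ 0 := ne_zero_of_natDegree_gt (hQdeg ▸ hA)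
  rw [splits_iff_card_roots]
  refine le_antisymm (card_roots' _) ?_
  calc (P - C ε * A).natDegree = #(S.biUnion T) := by
        rw [hQdeg, hPdeg, card_biUnion, sum_congr rfl hcard]
        intro z hz z' hz' hne
        refine disjoint_left.2 fun t ht ht' => ?_
        exact Set.disjoint_left.1 (hdisj hz hz' hne) (hT z hz t ht).1 (hT z' hz' t ht').1
    _ ≤ #(P - C ε * A).roots.toFinset := by
        refine card_le_card fun t ht => ?_
        obtain ⟨z, hz, htz⟩ := mem_biUnion.1 ht
        rw [Multiset.mem_toFinset, mem_roots hQ]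
        exact (hT z hz t htz).2
    _ ≤ (P - C ε * A).roots.card := Multiset.toFinset_card_le _

end Perturbation

section Minimal

variable {n s : ℕ} {F H : Hyp n}

theorem Hyp.rootMultiplicity_pos {z : ℝ} (hz : z ∈ H.distinctRoots) :
    0 < H.1.rootMultiplicity z := by
  rw [← count_roots]
  exact Multiset.count_pos.2 (Multiset.mem_toFinset.1 hz)

theorem Hyp.eq_prod_distinctRoots (H : Hyp n) :
    H.1 = ∏ z ∈ H.distinctRoots, (X - C z) ^ H.1.rootMultiplicity z := by
  conv_lhs => rw [H.2.2.2.eq_prod_roots_of_monic H.2.1]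
  exact prod_multiset_root_eq_finset_root

theorem not_isMinimalPoly_of_splits {B : ℝ[X]} (hB : B.Monic) (hdeg : B.natDegree + s + 1 = n)
    {ε : ℝ} (hε : 0 < ε) (hsplit : (H.1 - C ε * B).Splits) : ¬ IsMinimalPoly s F H := by
  rintro ⟨hmem, hmin⟩
  have hlt : (C ε * B).natDegree < H.1.natDegree := by
    rw [H.2.2.1]
    exact (natDegree_C_mul_le _ _).trans_lt (by lia)
  let G : Hyp n := ⟨H.1 - C ε * B, H.2.1.sub_of_left (degree_lt_degree hlt),
    (natDegree_sub_eq_left_of_natDegree_lt hlt).trans H.2.2.1, hsplit⟩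
  have hG : ∀ i, G.coef i = H.coef i - if i ≤ n then ε * B.coeff (n - i) else 0 := by
    intro i
    simp only [Hyp.coef, G, coeff_sub, coeff_C_mul]
    split_ifs <;> simp
  have hslice : G ∈ slice s F := by
    intro i h1 hi
    rw [hG, coeff_eq_zero_of_natDegree_lt (p := B) (by lia), mul_zero, ite_self, sub_zero]
    exact hmem i h1 hi
  have hlast := hG (s + 1)
  rw [if_pos (by lia), show n - (s + 1) = B.natDegree by lia, hB.coeff_natDegree, mul_one] at hlast
  linarith [hmin G hslice]

theorem not_isMinimalPoly_of_le_rootMultiplicity {m : ℝ → ℕ} {A : ℝ[X]} (hA : A.Monic)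
    (hle : ∀ z ∈ H.distinctRoots, m z ≤ H.1.rootMultiplicity z)
    (hdeg : A.natDegree + s + 1 = ∑ z ∈ H.distinctRoots, m z)
    (hm : ∀ z ∈ H.distinctRoots, m z = 1 ∨
      m z = 2 ∧ 0 < A.eval z * ∏ x ∈ H.distinctRoots.erase z, (z - x) ^ m x) :
    ¬ IsMinimalPoly s F H := by
  set P : ℝ[X] := ∏ z ∈ H.distinctRoots, (X - C z) ^ m z with hP
  set M : ℝ[X] := ∏ z ∈ H.distinctRoots, (X - C z) ^ (H.1.rootMultiplicity z - m z) with hM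
  have hMmonic : M.Monic := monic_prod_of_monic _ _ fun z _ => (monic_X_sub_C z).pow _
  have hPmonic : P.Monic := monic_prod_of_monic _ _ fun z _ => (monic_X_sub_C z).pow _
  have hPdeg : P.natDegree = A.natDegree + s + 1 := by
    rw [hdeg, hP, natDegree_prod_of_monic _ _ fun z _ => (monic_X_sub_C z).pow _]
    simp
  have hMP : H.1 = M * P := by
    rw [hP, hM, ← prod_mul_distrib]
    conv_lhs => rw [H.eq_prod_distinctRoots]
    refine prod_congr rfl fun z hz => ?_
    rw [← pow_add, Nat.sub_add_cancel (hle z hz)]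
  obtain ⟨ε, hsplit, hε⟩ := ((eventually_splits_sub_C_mul hP (by lia) hm).and
    self_mem_nhdsWithin).exists
  refine not_isMinimalPoly_of_splits (hMmonic.mul hA) ?_ hε ?_
  · have hn := H.2.2.1
    rw [hMP, hMmonic.natDegree_mul hPmonic] at hn
    rw [hMmonic.natDegree_mul hA]
    lia
  · have hMsplits : M.Splits := Splits.prod fun z _ => (Splits.X_sub_C z).pow _
    rw [hMP, show M * P - C ε * (M * A) = M * (P - C ε * A) by ring]
    exact hMsplits.mul hsplit

theorem IsMinimalPoly.card_distinctRoots_le (h : IsMinimalPoly s F H) :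
    #H.distinctRoots ≤ s := by
  by_contra! hlt
  refine not_isMinimalPoly_of_le_rootMultiplicity (m := 1) (A := X ^ (#H.distinctRoots - s - 1))
    (monic_X_pow _) (fun z hz => Hyp.rootMultiplicity_pos hz) ?_ (fun z _ => Or.inl rfl) h
  simp only [natDegree_X_pow, Pi.one_apply, sum_const, smul_eq_mul, mul_one]
  lia

theorem prod_sub_pos {S : Finset ℝ} {z : ℝ} (h : Even #{x ∈ S | z < x}) :
    0 < ∏ x ∈ S.erase z, (z - x) := by
  have habove : {x ∈ S.erase z | z < x} = {x ∈ S | z < x} := by grind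
  rw [← prod_filter_mul_prod_filter_not _ (z < ·), habove]
  refine mul_pos ?_ (prod_pos fun x hx => sub_pos.2 ?_)
  · rw [prod_congr rfl fun x _ => (neg_sub x z).symm, prod_neg, h.neg_one_pow, one_mul]
    exact prod_pos fun x hx => sub_pos.2 (mem_filter.1 hx).2
  · grind

/-- The alternating polynomials: with the roots in decreasing order, those at the positions
`1, 3, 5, …` are simple. They turn out to be the minimal polynomials of the generic slices. -/
def Hyp.IsAlternating (H : Hyp n) : Prop :=
  ∀ z ∈ H.distinctRoots, z ∉ evenPositions H.distinctRoots → H.1.rootMultiplicity z = 1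

theorem IsMinimalPoly.isAlternating (h : IsMinimalPoly s F H) (hcard : #H.distinctRoots = s) :
    H.IsAlternating := by
  intro z hz hzB
  have heven : Even #{x ∈ H.distinctRoots | z < x} := by
    simpa [evenPositions, hz] using hzB
  by_contra hne
  refine not_isMinimalPoly_of_le_rootMultiplicity (m := Function.update 1 z 2) (A := 1)
    monic_one (fun x hx => ?_) ?_ (fun x _ => ?_) h
  · have hpos := Hyp.rootMultiplicity_pos hx
    obtain rfl | hxz := eq_or_ne x z
    · rw [Function.update_self]
      lia
    · rwa [Function.update_of_ne hxz]
  · rw [sum_update_of_mem hz, ← erase_eq]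
    simp only [natDegree_one, Pi.one_apply, sum_const, smul_eq_mul, mul_one,
      card_erase_of_mem hz, hcard]
    have := card_pos.2 ⟨z, hz⟩
    lia
  · obtain rfl | hxz := eq_or_ne x z
    · refine Or.inr ⟨Function.update_self .., ?_⟩
      rw [eval_one, one_mul, prod_congr rfl fun y hy => by
        rw [Function.update_of_ne (ne_of_mem_erase hy), Pi.one_apply, pow_one]]
      exact prod_sub_pos heven
    · exact Or.inl (Function.update_of_ne hxz ..)

theorem Hyp.IsAlternating.isMinimalPoly (h : H.IsAlternating) (hcard : #H.distinctRoots = s)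
    (hH : H ∈ slice s F) : IsMinimalPoly s F H := by
  refine ⟨hH, fun G hG => ?_⟩
  obtain ⟨x, hx, rfl⟩ := exists_monotone_ofRoots H
  obtain ⟨y, hy, rfl⟩ := exists_monotone_ofRoots G
  have hslice : ofRoots x ∈ slice s (ofRoots y) := fun i h1 hi =>
    (hH i h1 hi).trans (hG i h1 hi).symm
  have hmem : ∀ i, x i ∈ (ofRoots x).distinctRoots := fun i => by
    rw [distinctRoots_ofRoots]
    exact mem_image_of_mem x (mem_univ i)
  rw [coef_succ_le_iff hslice]
  refine sum_pow_succ_le_of_separated (B := evenPositions (ofRoots x).distinctRoots) hy hx ?_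
    (by rw [card_evenPositions, hcard])
    (fun hs i => exists_mem_evenPositions_le (hcard ▸ hs) (hmem i))
    (fun k hk => (ofRoots_mem_slice_iff.1 hslice k hk).symm)
  intro i j hij hi hj
  have hne : x i ≠ x j := by
    intro heq
    have hsimple := h (x i) (hmem i) hi
    rw [rootMultiplicity_ofRoots] at hsimple
    exact hij.ne (card_le_one.1 hsimple.le i (by simp) j (by simp [heq]))
  exact exists_mem_evenPositions_between (hmem i) (hmem j) (lt_of_le_of_ne (hx hij.le) hne) hi hj

end Minimal

section Generic

variable {ι κ : Type*} [Fintype ι] {n s : ℕ}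

/-- The power sums of degrees `1, …, s` of the entries of a vector; on root vectors, a coordinate
system for the first `s` coefficients whose fibres are the slices. -/
def psumMap (s : ℕ) (x : ι → ℝ) : Fin s → ℝ := fun k => ∑ i, x i ^ ((k : ℕ) + 1)

theorem psumMap_eq_iff {x y : Fin n → ℝ} :
    psumMap s x = psumMap s y ↔ ofRoots x ∈ slice s (ofRoots y) := by
  rw [ofRoots_mem_slice_iff, funext_iff, Fin.forall_iff]
  rfl

theorem contDiff_psumMap : ContDiff ℝ ⊤ (psumMap s : (ι → ℝ) → Fin s → ℝ) := by
  unfold psumMap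
  fun_prop

theorem isGeneric_ofRoots_iff {x : Fin n → ℝ} :
    IsGeneric s (ofRoots x) ↔ psumMap s x ∉ psumMap s '' {y : Fin n → ℝ | #(univ.image y) < s} := by
  constructor
  · rintro h ⟨y, hy, hyx⟩
    exact h (ofRoots y) (psumMap_eq_iff.1 hyx) (by rwa [distinctRoots_ofRoots])
  · intro h H hH hcard
    obtain ⟨y, _, rfl⟩ := exists_monotone_ofRoots H
    rw [distinctRoots_ofRoots] at hcard
    exact h ⟨y, hcard, psumMap_eq_iff.2 hH⟩

theorem dense_compl_image_psumMap (s : ℕ) :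
    Dense (psumMap s '' {y : ι → ℝ | #(univ.image y) < s})ᶜ := by
  classical
  cases s with
  | zero => simp
  | succ s =>
    have hsubset : psumMap (s + 1) '' {y : ι → ℝ | #(univ.image y) < s + 1} ⊆
        ⋃ σ : ι → Fin s, Set.range fun z => psumMap (s + 1) (z ∘ σ) := by
      rintro _ ⟨y, hy, rfl⟩
      obtain ⟨e⟩ : Nonempty (univ.image y ↪ Fin s) :=
        Function.Embedding.nonempty_of_card_le (by simpa using Nat.le_of_lt_succ hy)
      refine Set.mem_iUnion.2 ⟨fun i => e ⟨y i, mem_image_of_mem y (mem_univ i)⟩,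
        Function.extend e Subtype.val 0, ?_⟩
      simp [Function.comp_def, e.injective.extend_apply]
    refine dense_compl_of_dimH_lt_finrank
      ((dimH_mono hsubset).trans_lt ((dimH_iUnion _).trans_lt ?_))
    refine (iSup_le fun σ => ContDiff.dimH_range_le ?_).trans_lt
      (Nat.cast_lt.2 (by simp : Module.finrank ℝ (Fin s → ℝ) < Module.finrank ℝ (Fin (s + 1) → ℝ)))
    exact (contDiff_psumMap.of_le le_top).comp (by fun_prop)

theorem hasStrictFDerivAt_psumMap (x : ι → ℝ) :
    HasStrictFDerivAt (psumMap s) (ContinuousLinearMap.pi fun k : Fin s =>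
      ∑ i, ((k + 1 : ℝ) * x i ^ (k : ℕ)) • ContinuousLinearMap.proj (R := ℝ) (φ := fun _ => ℝ) i)
      x := by
  refine hasStrictFDerivAt_pi'.2 fun k => HasStrictFDerivAt.fun_sum fun i _ => ?_
  refine ((hasStrictFDerivAt_apply i x).pow (k + 1)).congr_fderiv ?_
  ext v
  simp

theorem eq_zero_of_forall_sum_mul_eval_eq_zero {x : ι → ℝ} (hx : s ≤ #(univ.image x))
    {a : Fin s → ℝ}
    (h : ∀ q : ℝ[X], ∑ k : Fin s, (∑ i, ((k + 1 : ℝ) * x i ^ (k : ℕ)) * q.eval (x i)) * a k = 0) :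
    a = 0 := by
  set q : ℝ[X] := ∑ k : Fin s, monomial k ((k + 1 : ℝ) * a k) with hq
  have hcoeff (k : Fin s) : q.coeff k = (k + 1) * a k := by
    simp [hq, coeff_monomial, Fin.val_inj]
  have hsq : ∑ i, q.eval (x i) ^ 2 = 0 := by
    rw [← h q]
    simp only [sum_mul]
    rw [sum_comm]
    refine sum_congr rfl fun i _ => ?_
    rw [sq]
    nth_rw 1 [hq]
    rw [eval_finsetSum, sum_mul]
    refine sum_congr rfl fun k _ => ?_
    rw [eval_monomial]
    ring
  have hroot : ∀ z ∈ univ.image x, q.eval z = 0 := by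
    simpa [sum_eq_zero_iff_of_nonneg fun i _ => sq_nonneg (q.eval (x i))] using hsq
  have hdeg : q.degree < #(univ.image x) := by
    refine (degree_sum_le _ _).trans_lt ((Finset.sup_lt_iff (WithBot.bot_lt_coe _)).2 fun k _ => ?_)
    exact (degree_monomial_le _ _).trans_lt (Nat.cast_lt.2 (k.2.trans_le hx))
  have hzero : q = 0 := eq_zero_of_degree_lt_of_eval_finset_eq_zero _ hdeg hroot
  funext k
  have hk := hcoeff k
  rw [hzero, coeff_zero] at hk
  exact (mul_eq_zero.1 hk.symm).resolve_left (by positivity)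

theorem map_nhds_psumMap_comp [Finite κ] {σ : ι → κ} {y : κ → ℝ}
    (hy : s ≤ #(univ.image (y ∘ σ))) :
    map (fun z => psumMap s (z ∘ σ)) (𝓝 y) = 𝓝 (psumMap s (y ∘ σ)) := by
  have := Fintype.ofFinite κ
  have hderiv := (hasStrictFDerivAt_psumMap (s := s) (y ∘ σ)).comp y
    (LinearMap.funLeft ℝ ℝ σ).toContinuousLinearMap.hasStrictFDerivAt
  refine hderiv.map_nhds_eq_of_surj (by_contra fun hrange => ?_)
  obtain ⟨f, hf, hker⟩ := Submodule.exists_le_ker_of_lt_top _ (lt_top_iff_ne_top.2 hrange)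
  have ha : (fun k => f fun j => if k = j then 1 else 0) = 0 := by
    refine eq_zero_of_forall_sum_mul_eval_eq_zero hy fun q => ?_
    have hfq := hker ⟨fun j => q.eval (y j), rfl⟩
    rw [LinearMap.mem_ker, LinearMap.pi_apply_eq_sum_univ] at hfq
    simpa [LinearMap.funLeft] using hfq
  refine hf (LinearMap.ext fun v => ?_)
  simp only [LinearMap.pi_apply_eq_sum_univ f v, congrFun ha, Pi.zero_apply, smul_zero,
    sum_const_zero, LinearMap.zero_apply]

theorem frequently_isGeneric_comp [Finite κ] {σ : Fin n → κ} {y : κ → ℝ}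
    (hy : s ≤ #(univ.image (y ∘ σ))) : ∃ᶠ z in 𝓝 y, IsGeneric s (ofRoots (z ∘ σ)) := by
  simp only [isGeneric_ofRoots_iff]
  have hdense := mem_closure_iff_frequently.1
    (dense_compl_image_psumMap (ι := Fin n) s (psumMap s (y ∘ σ)))
  rw [← map_nhds_psumMap_comp hy, frequently_map] at hdense
  exact hdense

theorem mem_closure_strictMono {x : Fin n → ℝ} (hx : Monotone x) :
    x ∈ closure {y : Fin n → ℝ | StrictMono y} := by
  have htendsto : Tendsto (fun (δ : ℝ) (i : Fin n) => x i + δ * (i : ℕ)) (𝓝[>] 0) (𝓝 x) := by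
    refine tendsto_nhdsWithin_of_tendsto_nhds (Continuous.tendsto' (by fun_prop) _ _ ?_)
    simp
  refine mem_closure_of_tendsto htendsto (eventually_mem_nhdsWithin.mono fun δ hδ i j hij => ?_)
  exact add_lt_add_of_le_of_lt (hx hij.le) (mul_lt_mul_of_pos_left (Nat.cast_lt.2 hij) hδ)

theorem mem_closure_isGeneric (hsn : s ≤ n) {x : Fin n → ℝ} (hx : Monotone x) :
    x ∈ closure {y : Fin n → ℝ | IsGeneric s (ofRoots y)} := by
  refine closure_minimal (fun y hy => ?_) isClosed_closure (mem_closure_strictMono hx)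
  refine mem_closure_iff_frequently.2 (frequently_isGeneric_comp (σ := id) ?_)
  rwa [Function.comp_id, card_image_of_injective _ hy.injective, card_univ, Fintype.card_fin]

theorem isProperMap_psumMap (hs : 2 ≤ s) :
    IsProperMap (psumMap s : (ι → ℝ) → Fin s → ℝ) := by
  refine isProperMap_iff_isCompact_preimage.2 ⟨contDiff_psumMap.continuous, fun K hK =>
    Metric.isCompact_of_isClosed_isBounded (hK.isClosed.preimage contDiff_psumMap.continuous) ?_⟩
  obtain ⟨C, hC⟩ := hK.isBounded.exists_norm_le
  refine isBounded_iff_forall_norm_le.2 ⟨√C, fun x hx =>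
    (pi_norm_le_iff_of_nonneg (Real.sqrt_nonneg _)).2 fun i => Real.abs_le_sqrt ?_⟩
  calc x i ^ 2 ≤ ∑ i, x i ^ 2 := single_le_sum (fun j _ => sq_nonneg (x j)) (mem_univ i)
    _ = psumMap s x ⟨1, hs⟩ := rfl
    _ ≤ ‖psumMap s x ⟨1, hs⟩‖ := Real.le_norm_self _
    _ ≤ ‖psumMap s x‖ := norm_le_pi_norm _ _
    _ ≤ C := hC _ hx

theorem exists_isMinimalPoly (hs : 2 ≤ s) (x : Fin n → ℝ) :
    ∃ y : Fin n → ℝ, IsMinimalPoly s (ofRoots x) (ofRoots y) := by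
  have hK : IsCompact (psumMap s ⁻¹' {psumMap s x} : Set (Fin n → ℝ)) :=
    (isProperMap_psumMap hs).isCompact_preimage isCompact_singleton
  obtain ⟨y, hy, hmax⟩ := hK.exists_isMaxOn ⟨x, rfl⟩
    (f := fun y : Fin n → ℝ => ∑ i, y i ^ (s + 1)) (by fun_prop)
  refine ⟨y, psumMap_eq_iff.1 hy, fun G hG => ?_⟩
  obtain ⟨g, _, rfl⟩ := exists_monotone_ofRoots G
  have hg := psumMap_eq_iff.2 hG
  exact (coef_succ_le_iff (psumMap_eq_iff.1 (hy.trans hg.symm))).2 (hmax hg)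

end Generic

section Covering

variable {n s : ℕ}

theorem coarsens_of_roots_eq_map {G H : Hyp n} {u : ℝ → ℝ} (h : G.1.roots = H.1.roots.map u) :
    Coarsens G.partition H.partition := by
  have hmaps : ∀ t ∈ H.distinctRoots, u t ∈ G.distinctRoots := fun t ht => by
    rw [Hyp.distinctRoots, h]
    exact Multiset.mem_toFinset.2 (Multiset.mem_map_of_mem u (Multiset.mem_toFinset.1 ht))
  have hmult (r : ℝ) : ∑ t ∈ H.distinctRoots with u t = r, H.1.rootMultiplicity t =
      G.1.rootMultiplicity r := by
    rw [← count_roots, h, Multiset.count_map, ← Multiset.toFinset_sum_count_eq,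
      Multiset.toFinset_filter]
    refine sum_congr (filter_congr fun t _ => eq_comm) fun t ht => ?_
    rw [Multiset.count_filter_of_pos (p := (r = u ·)) (mem_filter.1 ht).2, count_roots]
  have hsingleton (S : Finset ℝ) :
      S.val.map (H.1.rootMultiplicity ·) = ∑ t ∈ S, {H.1.rootMultiplicity t} := by
    rw [Finset.sum, ← Function.comp_def (fun a : ℕ => ({a} : Multiset ℕ)), ← Multiset.map_map,
      Multiset.sum_map_singleton]
  refine ⟨G.distinctRoots.val.map fun r =>
    {t ∈ H.distinctRoots | u t = r}.val.map (H.1.rootMultiplicity ·), ?_, ?_⟩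
  · simp only [hsingleton]
    change ∑ r ∈ G.distinctRoots, _ = H.distinctRoots.val.map (H.1.rootMultiplicity ·)
    rw [sum_fiberwise_of_maps_to hmaps, hsingleton]
  · rw [Multiset.map_map]
    exact Multiset.map_congr rfl fun r _ => hmult r

theorem coarsens_of_factorsThrough {x y : Fin n → ℝ} (h : x.FactorsThrough y) :
    Coarsens (ofRoots x).partition (ofRoots y).partition := by
  obtain ⟨u, rfl⟩ := (Function.factorsThrough_iff x).1 h
  exact coarsens_of_roots_eq_map (u := u) (by simp only [roots_ofRoots, Multiset.map_map])

theorem isClosed_setOf_factorsThrough {ι X β : Type*} [Finite ι] [TopologicalSpace X] [T2Space X]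
    (T : Set (ι → β)) : IsClosed {x : ι → X | ∃ y ∈ T, x.FactorsThrough y} := by
  have hunion : {x : ι → X | ∃ y ∈ T, x.FactorsThrough y} =
      ⋃ r ∈ (fun (y : ι → β) (i j : ι) => y i = y j) '' T,
        {x : ι → X | ∀ i j, r i j → x i = x j} := by
    ext x
    simp only [Set.mem_ofPred_eq, Set.biUnion_image, Set.mem_iUnion, exists_prop]
    rfl
  rw [hunion]
  refine (Set.toFinite _).isClosed_biUnion fun r _ => ?_
  simp only [Set.ofPred_forall]
  exact isClosed_iInter fun i => isClosed_iInter fun j => isClosed_iInter fun _ =>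
    isClosed_eq (continuous_apply i) (continuous_apply j)

/- Having a root vector that factors through one whose partition lies in `minPartitions n s` is a
closed condition, and `psumMap` is a closed map, so the property passes from generic slices to all
slices. -/
theorem exists_coarsens_mem_slice (hs : 2 ≤ s) (hsn : s ≤ n) (F : Hyp n) :
    ∃ q ∈ minPartitions n s, ∃ G ∈ slice s F, Coarsens G.partition q := by
  obtain ⟨x, hx, rfl⟩ := exists_monotone_ofRoots F
  set Z : Set (Fin n → ℝ) :=
    {y | ∃ z ∈ {z | (ofRoots z).partition ∈ minPartitions n s}, y.FactorsThrough z}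
  have hclosed : IsClosed (psumMap s ⁻¹' (psumMap s '' Z) : Set (Fin n → ℝ)) :=
    ((isProperMap_psumMap hs).isClosedMap _ (isClosed_setOf_factorsThrough _)).preimage
      contDiff_psumMap.continuous
  have hgeneric : {y : Fin n → ℝ | IsGeneric s (ofRoots y)} ⊆ psumMap s ⁻¹' (psumMap s '' Z) := by
    intro y hy
    obtain ⟨z, hz⟩ := exists_isMinimalPoly hs y
    exact ⟨z, ⟨z, ⟨_, _, hy, hz, rfl⟩, fun _ _ => id⟩, psumMap_eq_iff.2 hz.1⟩
  obtain ⟨y, ⟨z, hz, hyz⟩, hyx⟩ := closure_minimal hgeneric hclosed (mem_closure_isGeneric hsn hx)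
  exact ⟨_, hz, ofRoots y, psumMap_eq_iff.1 hyx, coarsens_of_factorsThrough hyz⟩

end Covering

section Partitions

variable {ι : Type*} [Fintype ι] {n s : ℕ}

theorem distinctRoots_ofRoots_comp (z : ι → ℝ) {σ : Fin n → ι} (hσ : σ.Surjective) :
    (ofRoots (z ∘ σ)).distinctRoots = univ.image z := by
  classical rw [distinctRoots_ofRoots, ← image_image, image_univ_of_surjective hσ]

theorem rootMultiplicity_ofRoots_comp {κ : Type*} [DecidableEq κ] {z : κ → ℝ} (hz : z.Injective)
    (σ : Fin n → κ) (j : κ) : (ofRoots (z ∘ σ)).1.rootMultiplicity (z j) = #{i | σ i = j} := by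
  simp only [rootMultiplicity_ofRoots, Function.comp_apply, hz.eq_iff]

theorem parts_partition_ofRoots_comp [DecidableEq ι] {z : ι → ℝ} (hz : z.Injective)
    {σ : Fin n → ι} (hσ : σ.Surjective) :
    (ofRoots (z ∘ σ)).partition.parts = univ.val.map fun j => #{i | σ i = j} := by
  change (ofRoots (z ∘ σ)).distinctRoots.val.map _ = _
  rw [distinctRoots_ofRoots_comp z hσ, image_val_of_injOn hz.injOn, Multiset.map_map]
  exact Multiset.map_congr rfl fun j _ => rootMultiplicity_ofRoots_comp hz σ j

theorem isAlternating_ofRoots_comp [LinearOrder ι] {z : ι → ℝ} (hz : StrictMono z)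
    {σ : Fin n → ι} (hσ : σ.Surjective) (h : ∀ j ∉ evenPositions univ, #{i | σ i = j} = 1) :
    (ofRoots (z ∘ σ)).IsAlternating := by
  rw [Hyp.IsAlternating, distinctRoots_ofRoots_comp z hσ, evenPositions_image hz]
  rintro _ hzj hj
  obtain ⟨j, -, rfl⟩ := mem_image.1 hzj
  rw [rootMultiplicity_ofRoots_comp hz.injective]
  exact h j fun hjB => hj (mem_image_of_mem z hjB)

theorem eventually_strictMono {κ : Type*} [Finite κ] [Preorder κ] {y : κ → ℝ} (hy : StrictMono y) :
    ∀ᶠ z in 𝓝 y, StrictMono z := by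
  simp only [StrictMono, eventually_all]
  exact fun i j hij => (continuous_apply i).continuousAt.eventually_lt
    (continuous_apply j).continuousAt (hy hij)

theorem exists_card_fiber_eq {κ : Type*} [Fintype κ] [DecidableEq κ] (w : κ → ℕ)
    (hw : ∑ j, w j = Fintype.card ι) : ∃ σ : ι → κ, ∀ j, #{i | σ i = j} = w j := by
  obtain ⟨e⟩ : Nonempty (ι ≃ Σ j, Fin (w j)) :=
    Fintype.card_eq.1 (by simp [hw])
  refine ⟨fun i => (e i).1, fun j => ?_⟩
  rw [← Fintype.card_subtype, ← Fintype.card_fin (w j)]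
  exact Fintype.card_congr ((e.subtypeEquiv fun i => Iff.rfl).trans (Equiv.sigmaSubtype j))

theorem exists_map_univ_eq_of_le_count {β : Type*} [DecidableEq β]
    {m : Multiset β} (hm : Multiset.card m = Fintype.card ι) {T : Finset ι} {b : β}
    (hT : #T ≤ m.count b) : ∃ w : ι → β, univ.val.map w = m ∧ ∀ i ∈ T, w i = b := by
  classical
  obtain ⟨e⟩ : Nonempty (ι ≃ m) := Fintype.card_eq.1 (by simp [hm])
  have hw : univ.val.map (fun i => (e i).1) = m := by
    rw [← Function.comp_def (fun t : m => t.1) e, ← Multiset.map_map, Multiset.map_univ_val_equiv,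
      Multiset.map_univ_coe]
  have hcount : #T ≤ #{i | (e i).1 = b} := by
    rw [← hw, Multiset.count_map] at hT
    simp only [eq_comm (a := b)] at hT
    exact hT
  obtain ⟨C, hC, hCT⟩ := exists_subset_card_eq hcount
  obtain ⟨e'⟩ : Nonempty ({i // i ∈ T} ≃ {i // i ∈ C}) := Fintype.card_eq.1 (by simp [hCT])
  refine ⟨fun i => (e (e'.extendSubtype i)).1, ?_, fun i hi => ?_⟩
  · rw [← Function.comp_def (fun i => (e i).1) e'.extendSubtype, ← Multiset.map_map,
      Multiset.map_univ_val_equiv, hw]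
  · exact (mem_filter.1 (hC (e'.extendSubtype_mem i hi))).2

theorem Hyp.IsAlternating.le_count_one {H : Hyp n} (h : H.IsAlternating) :
    #H.distinctRoots - #H.distinctRoots / 2 ≤ H.partition.parts.count 1 := by
  have hsimple : H.distinctRoots \ evenPositions H.distinctRoots ⊆
      {z ∈ H.distinctRoots | 1 = H.1.rootMultiplicity z} := by
    intro z hz
    obtain ⟨hz, hzB⟩ := mem_sdiff.1 hz
    exact mem_filter.2 ⟨hz, (h z hz hzB).symm⟩
  rw [Hyp.partition, Multiset.count_map, ← card_evenPositions,
    ← card_sdiff_of_subset (evenPositions_subset _)]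
  exact card_le_card hsimple

theorem mem_minPartitions_of_le_count_one {p : n.Partition} (hcard : Multiset.card p.parts = s)
    (hcount : s - s / 2 ≤ p.parts.count 1) : p ∈ minPartitions n s := by
  obtain ⟨w, hw, hw_one⟩ := exists_map_univ_eq_of_le_count (ι := Fin s) (m := p.parts)
    (T := univ \ evenPositions univ) (by simpa using hcard) (by
      rwa [card_sdiff_of_subset (evenPositions_subset _), card_evenPositions, card_univ,
        Fintype.card_fin])
  obtain ⟨σ, hσ⟩ := exists_card_fiber_eq (ι := Fin n) w (by
    rw [Fintype.card_fin, ← p.parts_sum, ← hw]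
    rfl)
  have hσ_surj : σ.Surjective := fun j => by
    obtain ⟨i, hi⟩ := card_pos.1 ((hσ j).symm ▸ p.parts_pos (hw ▸ Multiset.mem_map_of_mem w
      (mem_univ j)))
    exact ⟨i, (mem_filter.1 hi).2⟩
  have hcardRoots {z : Fin s → ℝ} (hz : StrictMono z) : #(univ.image (z ∘ σ)) = s := by
    rw [← image_image, image_univ_of_surjective hσ_surj, card_image_of_injective _ hz.injective,
      card_univ, Fintype.card_fin]
  have hy : StrictMono fun j : Fin s => (j : ℝ) := fun _ _ hij => Nat.cast_lt.2 hij
  obtain ⟨z, hgeneric, hz⟩ := ((frequently_isGeneric_comp (hcardRoots hy).ge).and_eventually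
    (eventually_strictMono hy)).exists
  refine ⟨ofRoots (z ∘ σ), ofRoots (z ∘ σ), hgeneric, Hyp.IsAlternating.isMinimalPoly
    (isAlternating_ofRoots_comp hz hσ_surj fun j hj => ?_) ?_ fun _ _ _ => rfl,
    Nat.Partition.ext ?_⟩
  · rw [hσ, hw_one j (by simpa using hj)]
  · rw [distinctRoots_ofRoots, hcardRoots hz]
  · rw [parts_partition_ofRoots_comp hz.injective hσ_surj, ← hw]
    simp only [hσ]

theorem minPartitions_eq : minPartitions n s =
    {p | Multiset.card p.parts = s ∧ s - s / 2 ≤ p.parts.count 1} := by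
  ext p
  refine ⟨?_, fun hp => mem_minPartitions_of_le_count_one hp.1 hp.2⟩
  rintro ⟨F, H, hF, hH, rfl⟩
  have hcard : #H.distinctRoots = s :=
    hH.card_distinctRoots_le.antisymm (not_lt.1 (hF H hH.1))
  refine ⟨by simpa [Hyp.partition] using hcard, ?_⟩
  simpa only [hcard] using (hH.isAlternating hcard).le_count_one

/-- The partition obtained by adding `c` parts equal to `1`. -/
def addOnes {n c : ℕ} (hc : c ≤ n) (q : (n - c).Partition) : n.Partition where
  parts := q.parts + Multiset.replicate c 1
  parts_pos hi := (Multiset.mem_add.1 hi).elim q.parts_pos fun h =>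
    Multiset.eq_of_mem_replicate h ▸ one_pos
  parts_sum := by
    rw [Multiset.sum_add, q.parts_sum, Multiset.sum_replicate, smul_eq_mul, mul_one,
      Nat.sub_add_cancel hc]

theorem addOnes_injective {c : ℕ} (hc : c ≤ n) : Function.Injective (addOnes hc) :=
  fun _ _ h => Nat.Partition.ext (Multiset.add_left_inj.1 (congrArg Nat.Partition.parts h))

theorem addOnes_image_partitionsInto {c : ℕ} (hc : c ≤ n) (k : ℕ) :
    addOnes hc '' partitionsInto (n - c) k =
      {p | Multiset.card p.parts = k + c ∧ c ≤ p.parts.count 1} := by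
  ext p
  constructor
  · rintro ⟨q, hq, rfl⟩
    change Multiset.card q.parts = k at hq
    simp [addOnes, hq]
  · rintro ⟨hcard, hcount⟩
    obtain ⟨m, hm⟩ := Multiset.le_iff_exists_add.1 (Multiset.le_count_iff_replicate_le.1 hcount)
    have hsum := p.parts_sum
    rw [hm, Multiset.sum_add, Multiset.sum_replicate, smul_eq_mul, mul_one] at hsum
    rw [hm, Multiset.card_add, Multiset.card_replicate] at hcard
    refine ⟨⟨m, fun hi => p.parts_pos (hm ▸ Multiset.mem_add.2 (Or.inr hi)), by lia⟩, ?_,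
      Nat.Partition.ext ((add_comm _ _).trans hm.symm)⟩
    change Multiset.card m = k
    lia

theorem ncard_minPartitions (hsn : s ≤ n) :
    (minPartitions n s).ncard = (partitionsInto (n - (s - s / 2)) (s / 2)).ncard := by
  have hc : s - s / 2 ≤ n := (Nat.sub_le _ _).trans hsn
  rw [← Set.ncard_image_of_injective _ (addOnes_injective hc), addOnes_image_partitionsInto,
    Nat.add_sub_cancel' (Nat.div_le_self _ _), minPartitions_eq]

theorem isVandermondeCovering_minPartitions (hs : 2 ≤ s) (hsn : s ≤ n) :
    IsVandermondeCovering n s (minPartitions n s) := by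
  refine ⟨?_, exists_coarsens_mem_slice hs hsn⟩
  rw [minPartitions_eq]
  exact fun p hp => hp.1

end Partitions

end HyperbolicSlice

theorem theorem4 (n s : ℕ) (hs : 2 ≤ s) (hsn : s ≤ n) :
    HyperbolicSlice.IsVandermondeCovering n s (HyperbolicSlice.minPartitions n s) ∧
      (HyperbolicSlice.minPartitions n s).ncard =
        (HyperbolicSlice.partitionsInto (n - ⌈(s : ℚ) / 2⌉₊) ⌊(s : ℚ) / 2⌋₊).ncard := by
  have hfloor : ⌊(s : ℚ) / 2⌋₊ = s / 2 := Nat.floor_div_eq_div s 2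
  have hceil : ⌈(s : ℚ) / 2⌉₊ = s - s / 2 := by
    refine eq_of_forall_ge_iff fun k => ?_
    rw [Nat.ceil_le, div_le_iff₀ two_pos]
    norm_cast
    lia
  rw [hfloor, hceil]
  exact ⟨HyperbolicSlice.isVandermondeCovering_minPartitions hs hsn,
    HyperbolicSlice.ncard_minPartitions hsn⟩
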